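/- **Theorem 3.5.** For a number field $\mathbb{K}\subset\mathbb{C}$ and integers $k>1$, $q>2$, let $\widehat{V}_k(q,\mathbb{K})\subset\mathbb{C}$ be the $\mathbb{K}$-linear space generated by $1$ and the numbers $\zeta(k,a/q)$ with $1\le a<q$, $(a,q)=1$, where $\zeta(k,x)=\sum_{n=0}^{\infty}\frac{1}{(n+x)^k}$ is the Hurwitz zeta function. Let $k>1$ be an odd integer and let $q,r>2$ be two coprime integers. Let $\mathbb{K}$ be a real number field (that is, $\mathbb{K}\subset\mathbb{R}$ and $[\mathbb{K}:\mathbb{Q}]<\infty$) whose discriminant $d_{\mathbb{K}}$ is coprime to $qr$, and assume that $\zeta(k)\notin\mathbb{K}$, where $\zeta$ is the Riemann zeta function. Then $$\dim_{\mathbb{K}}\widehat{V}_k(q,\mathbb{K})\ \ge\ \frac{\varphi(q)}{2}+2\qquad\text{or}\qquad \dim_{\mathbb{K}}\widehat{V}_k(r,\mathbb{K})\ \ge\ \frac{\varphi(r)}{2}+2,$$ where $\varphi$ is Euler's totient function. -/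

import Mathlib

/-- The space `V̂_k(q, K)`, for a number field `K ⊆ ℂ`: the `K`-linear span, inside `ℂ`, of `1` and
the Hurwitz zeta values `ζ(k, a/q)` with `1 ≤ a < q` and `(a, q) = 1`. (As `0 < a/q < 1` and, in use,
`k > 1`, Mathlib's `hurwitzZeta` is here the sum of the series `∑ 1 / (n + a/q) ^ k` over `n ≥ 0`.) -/
noncomputable def hurwitzSpace (k q : ℕ) (K : Subfield ℂ) : Submodule K ℂ :=
  Submodule.span K
    (insert 1 {z : ℂ | ∃ a : ℕ, 1 ≤ a ∧ a < q ∧ Nat.Coprime a q ∧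
      z = HurwitzZeta.hurwitzZeta (((a : ℝ) / (q : ℝ) : ℝ) : UnitAddCircle) (k : ℂ)})

open Polynomial

/-! Suppose both dimensions are too small. Each space contains 1, ζ(k) and the φ/2 differences
ζ(k,a/q) − ζ(k,1−a/q), which are independent over K (Okada), so a nontrivial combination of 1 and
ζ(k) lies in the span of the differences. For odd k the differences are iπ^k times cyclotomic
numbers, whence α + βζ(k) = iπ^k x and γ + δζ(k) = iπ^k y with x ∈ K(ζ_q), y ∈ K(ζ_r). Here x ≠ 0
because ζ(k) ∉ K.

If αδ ≠ βγ, eliminating ζ(k) makes π^k algebraic, against `transcendental_pi`. Otherwise γx = αy and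
δx = βy. Coprime discriminants keep the qr-th cyclotomic polynomial irreducible over K, so some
automorphism inverts q-th roots of unity and fixes r-th ones. It negates x and fixes y, forcing γ =
δ = 0, a contradiction.

Okada's theorem rests on the same irreducibility and on L(k,χ) ≠ 0. -/

/-! ### Irreducibility of cyclotomic polynomials over K. -/

/-- The discriminant of A ∩ B divides both discriminants, so it is a unit, and Minkowski's bound
gives A ∩ B = ℚ. As A is Galois, this suffices. -/
theorem NumberField.linearDisjoint_of_isGalois_of_isCoprime_discr {L : Type*} [Field L] [CharZero L]
    (A B : IntermediateField ℚ L)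
    [IsGalois ℚ A] [NumberField A] [NumberField B]
    (h : IsCoprime (NumberField.discr A) (NumberField.discr B)) : A.LinearDisjoint B := by
  have hG : @IsGalois ℚ _ A _ A.algebra' := by assumption
  refine @IntermediateField.LinearDisjoint.of_inf_eq_bot ℚ L _ _ _ A B hG
    NumberField.to_finiteDimensional NumberField.to_finiteDimensional ?_
  let iA : Algebra ↥(A ⊓ B) A := (IntermediateField.inclusion inf_le_left).toRingHom.toAlgebra
  let iB : Algebra ↥(A ⊓ B) B := (IntermediateField.inclusion inf_le_right).toRingHom.toAlgebra
  have : FiniteDimensional ℚ ↥(A ⊓ B) :=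
    FiniteDimensional.of_injective
      (IntermediateField.inclusion (inf_le_left : A ⊓ B ≤ A)).toLinearMap
      (IntermediateField.inclusion (inf_le_left : A ⊓ B ≤ A)).injective
  have : CharZero ↥(A ⊓ B) := algebraRat.charZero _
  have : NumberField ↥(A ⊓ B) := ⟨⟩
  suffices IsUnit (NumberField.discr ↥(A ⊓ B)) by
    contrapose! this
    have : 1 < Module.finrank ℚ ↥(A ⊓ B) := by
      refine Nat.one_lt_iff_ne_zero_and_ne_one.mpr ⟨Module.finrank_pos.ne', ?_⟩
      rwa [ne_eq, ← IntermediateField.finrank_eq_one_iff] at this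
    exact Int.isUnit_iff_abs_eq.not.mpr <| by linarith [NumberField.abs_discr_gt_two this]
  exact h.isUnit_of_dvd' (NumberField.discr_dvd_discr _ _) (NumberField.discr_dvd_discr _ _)

theorem IsCyclotomicExtension.Rat.isCoprime_discr (n : ℕ) [NeZero n] (L : Type*) [Field L]
    [NumberField L] [IsCyclotomicExtension {n} ℚ L] {d : ℤ} (h : IsCoprime d n) :
    IsCoprime (NumberField.discr L) d := by
  have h1 : IsCoprime ((n : ℤ) ^ n.totient) d := (IsCoprime.pow_right h).symm
  refine h1.of_isCoprime_of_dvd_left ?_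
  rw [← Int.natAbs_dvd, IsCyclotomicExtension.Rat.natAbs_discr n L]
  exact_mod_cast Nat.div_dvd_of_dvd (Nat.prod_primeFactors_pow_totient_ediv_dvd (NeZero.pos n))

theorem IsPrimitiveRoot.isCyclotomicExtension_intermediateField_adjoin (K : Type*) {L : Type*}
    [Field K] [Field L] [Algebra K L] {n : ℕ} [NeZero n] {ζ : L} (hζ : IsPrimitiveRoot ζ n) :
    IsCyclotomicExtension {n} K (IntermediateField.adjoin K {ζ}) := by
  change IsCyclotomicExtension {n} K (IntermediateField.adjoin K {ζ}).toSubalgebra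
  rw [IntermediateField.adjoin_simple_toSubalgebra_of_isAlgebraic
    (hζ.isIntegral (NeZero.pos n)).tower_top.isAlgebraic]
  exact hζ.adjoin_isCyclotomicExtension K

/-- By linear disjointness a power basis of ℚ(ζ) stays independent over K, so ζ still has degree at
least φ(n). -/
theorem Subfield.irreducible_cyclotomic_of_isCoprime_discr {n : ℕ} [NeZero n] (K : Subfield ℂ)
    [NumberField K] (h : IsCoprime (NumberField.discr K) n) : Irreducible (cyclotomic n K) := by
  let B : IntermediateField ℚ ℂ := K.toIntermediateField fun x ↦ by simp
  let e : K ≃ₐ[ℚ] B := (RingEquiv.refl K : K ≃+* B).toRatAlgEquiv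
  have : FiniteDimensional ℚ B := e.toLinearEquiv.finiteDimensional
  have : NumberField B := ⟨⟩
  have hn : n ≠ 0 := NeZero.ne n
  have hζ := Complex.isPrimitiveRoot_exp n hn
  set ζ := Complex.exp (2 * Real.pi * Complex.I / n)
  let A : IntermediateField ℚ ℂ := IntermediateField.adjoin ℚ {ζ}
  have : IsCyclotomicExtension {n} ℚ A :=
    hζ.isCyclotomicExtension_intermediateField_adjoin ℚ
  have : NumberField A := IsCyclotomicExtension.numberField {n} ℚ A
  have : FiniteDimensional ℚ A := IsCyclotomicExtension.finiteDimensional {n} ℚ A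
  have : IsGalois ℚ A := IsCyclotomicExtension.isGalois {n} ℚ A
  have hd : A.LinearDisjoint B :=
    NumberField.linearDisjoint_of_isGalois_of_isCoprime_discr A B
      (IsCyclotomicExtension.Rat.isCoprime_discr n A
        (by rwa [← NumberField.discr_eq_discr_of_algEquiv K e]))
  have hζA : IsPrimitiveRoot (IntermediateField.AdjoinSimple.gen ℚ ζ) n :=
    IsPrimitiveRoot.of_map_of_injective (f := A.val)
      (by simpa using hζ) A.val.injective
  let pb : PowerBasis ℚ A := hζA.powerBasis ℚ
  have hli : LinearIndependent B (A.val ∘ pb.basis) :=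
    hd.linearIndependent_left pb.basis.linearIndependent
  have hli' : LinearIndependent K (A.val ∘ pb.basis) := hli
  have hint : IsIntegral K ζ := (hζ.isIntegral (NeZero.pos n)).tower_top
  have hdeg : n.totient ≤ (minpoly K ζ).natDegree := by
    have : FiniteDimensional K (IntermediateField.adjoin K {ζ}) :=
      IntermediateField.adjoin.finiteDimensional hint
    have hmem (i : Fin pb.dim) : (pb.basis i : ℂ) ∈ IntermediateField.adjoin K {ζ} := by
      rw [pb.coe_basis]
      exact pow_mem (IntermediateField.mem_adjoin_simple_self K ζ) _
    have h1 : LinearIndependent K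
        fun i ↦ (⟨_, hmem i⟩ : IntermediateField.adjoin K {ζ}) :=
      LinearIndependent.of_comp (IntermediateField.adjoin K {ζ}).val.toLinearMap hli'
    have h2 := h1.fintype_card_le_finrank
    rwa [IntermediateField.adjoin.finrank hint, Fintype.card_fin, ← pb.finrank,
      IsCyclotomicExtension.finrank A (cyclotomic.irreducible_rat (NeZero.pos n))] at h2
  have hdvd : minpoly K ζ ∣ cyclotomic n K := by
    apply minpoly.dvd
    rw [aeval_def, eval₂_eq_eval_map, map_cyclotomic]
    exact (isRoot_cyclotomic_iff.2 hζ)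
  have : minpoly K ζ = cyclotomic n K := by
    refine (eq_of_monic_of_dvd_of_natDegree_le (minpoly.monic hint) (cyclotomic.monic n K) hdvd ?_).symm
    rwa [natDegree_cyclotomic]
  rw [← this]
  exact minpoly.irreducible hint

/-- `K`-linear relations between `n`-th roots of unity are preserved by the action of
`(ZMod n)ˣ` when the `n`-th cyclotomic polynomial is irreducible over `K`. -/
theorem Subfield.sum_mul_stdAddChar_unit_mul_eq_zero {n : ℕ} [NeZero n] (K : Subfield ℂ)
    (h : Irreducible (cyclotomic n K)) (u : (ZMod n)ˣ) {ι : Type*} [Fintype ι] (d : ι → K)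
    (t : ι → ZMod n) (h0 : ∑ i, (d i : ℂ) * ZMod.stdAddChar (t i) = 0) :
    ∑ i, (d i : ℂ) * ZMod.stdAddChar ((u : ZMod n) * t i) = 0 := by
  have hζ := Complex.isPrimitiveRoot_exp n (NeZero.ne n)
  have hexp : Complex.exp (2 * Real.pi * Complex.I / n) = ZMod.stdAddChar (1 : ZMod n) := by
    simpa using (ZMod.stdAddChar_coe (N := n) 1).symm
  rw [hexp] at hζ
  set ζ : ℂ := ZMod.stdAddChar (1 : ZMod n) with hζdef
  have hpow (j : ZMod n) : (ZMod.stdAddChar j : ℂ) = ζ ^ j.val := by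
    rw [hζdef, ← AddChar.map_nsmul_eq_pow]
    simp
  have hu : IsPrimitiveRoot (ζ ^ (u : ZMod n).val) n :=
    hζ.pow_of_coprime _ (ZMod.val_coe_unit_coprime u)
  -- Both ζ and ζ^u are roots of the irreducible cyclotomic polynomial.
  have hmin : minpoly K (ζ ^ (u : ZMod n).val) = minpoly K ζ :=
    (hu.minpoly_eq_cyclotomic_of_irreducible h).symm.trans
      (hζ.minpoly_eq_cyclotomic_of_irreducible h)
  have h1 : aeval ζ (∑ i, C (d i) * X ^ (t i).val) = 0 := by
    rw [← h0, map_sum]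
    refine Finset.sum_congr rfl fun i _ ↦ ?_
    rw [map_mul, aeval_C, map_pow, aeval_X, hpow]
    rfl
  have h2 := (aeval_eq_zero_of_dvd_aeval_eq_zero (hmin ▸ minpoly.dvd K ζ h1)
    (minpoly.aeval K (ζ ^ (u : ZMod n).val)))
  rw [← h2, map_sum]
  refine Finset.sum_congr rfl fun i _ ↦ ?_
  have hexp : (ZMod.stdAddChar ((u : ZMod n) * t i) : ℂ) = (ζ ^ (u : ZMod n).val) ^ (t i).val := by
    rw [← pow_mul, hζdef, ← AddChar.map_nsmul_eq_pow]
    simp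
  rw [hexp, map_mul (aeval (ζ ^ (u : ZMod n).val)), aeval_C, map_pow, aeval_X]
  rfl

/-! ### Transcendence of π, by Hermite's approximations. -/

theorem Polynomial.isIntegral_smul_aeval {A : Type*} [CommRing A] (g : ℤ[X]) {D : ℤ}
    {x : A} (hx : IsIntegral ℤ (D • x)) {N : ℕ} (hN : g.natDegree ≤ N) :
    IsIntegral ℤ (D ^ N • aeval x g) := by
  rw [aeval_eq_sum_range, Finset.smul_sum]
  refine IsIntegral.sum _ fun i hi ↦ ?_
  have hi' : i ≤ N := (Nat.lt_succ_iff.1 (Finset.mem_range.1 hi)).trans hN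
  have : D ^ N • g.coeff i • x ^ i = (D ^ (N - i) * g.coeff i) • (D • x) ^ i := by
    rw [_root_.smul_pow, smul_smul, smul_smul]
    congr 1
    rw [mul_right_comm, ← pow_add, Nat.sub_add_cancel hi']
  rw [this]
  exact (hx.pow i).smul _

theorem exists_intCast_eq_of_isIntegral_of_fixed {E : Type*} [Field E] [Algebra ℚ E]
    [FiniteDimensional ℚ E] [IsGalois ℚ E] {x : E} (hx : IsIntegral ℤ x)
    (hfix : ∀ σ : E ≃ₐ[ℚ] E, σ x = x) : ∃ z : ℤ, (z : E) = x := by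
  obtain ⟨y, rfl⟩ := (IsGalois.mem_range_algebraMap_iff_fixed x).2 hfix
  have hy : IsIntegral ℤ y :=
    (isIntegral_algebraMap_iff (algebraMap ℚ E).injective).1 hx
  obtain ⟨z, rfl⟩ := IsIntegrallyClosed.isIntegral_iff.1 hy
  exact ⟨z, by simp⟩

theorem exists_int_smul_isIntegral {E ι : Type*} [Field E] [Algebra ℚ E] [FiniteDimensional ℚ E]
    [Fintype ι] (β : ι → E) : ∃ D : ℤ, D ≠ 0 ∧ ∀ i, IsIntegral ℤ (D • β i) := by
  classical
  have halg (x : E) : IsAlgebraic ℤ x :=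
    (IsFractionRing.isAlgebraic_iff ℤ ℚ E).2 (Algebra.IsAlgebraic.isAlgebraic x)
  choose D hD hint using fun i ↦ (halg (β i)).exists_integral_multiple
  refine ⟨∏ i, D i, Finset.prod_ne_zero_iff.2 fun i _ ↦ hD i, fun i ↦ ?_⟩
  rw [← Finset.prod_erase_mul _ _ (Finset.mem_univ i), mul_smul]
  exact (hint i).smul _

theorem exists_int_polynomial_aeval_eq_zero {E ι : Type*} [Field E] [Algebra ℚ E]
    [FiniteDimensional ℚ E] [Fintype ι] (β : ι → E) :
    ∃ f : ℤ[X], f.eval 0 ≠ 0 ∧ ∀ i, β i ≠ 0 → aeval (β i) f = 0 := by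
  classical
  have halg (x : E) : IsAlgebraic ℤ x :=
    (IsFractionRing.isAlgebraic_iff ℤ ℚ E).2 (Algebra.IsAlgebraic.isAlgebraic x)
  have (i : ι) : ∃ f : ℤ[X], f.eval 0 ≠ 0 ∧ (β i ≠ 0 → aeval (β i) f = 0) := by
    by_cases h : β i = 0
    · exact ⟨1, by simp, fun h' ↦ (h' h).elim⟩
    · obtain ⟨q, hq, hq0⟩ := (halg (β i)).exists_nonzero_coeff_and_aeval_eq_zero
        (mem_nonZeroDivisors_of_ne_zero h)
      exact ⟨q, by rwa [← coeff_zero_eq_eval_zero], fun _ ↦ hq0⟩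
  choose f hf hf0 using this
  refine ⟨∏ i, f i, ?_, fun i hi ↦ ?_⟩
  · rw [eval_prod]
    exact Finset.prod_ne_zero_iff.2 fun i _ ↦ hf i
  · rw [map_prod]
    exact Finset.prod_eq_zero (Finset.mem_univ i) (hf0 i hi)

theorem exists_prime_gt_mul_pow_div_factorial_lt_one (N : ℕ) (m c : ℝ) :
    ∃ p : ℕ, p.Prime ∧ N < p ∧ m * (c ^ p / (p - 1).factorial) < 1 := by
  have h := (FloorSemiring.tendsto_pow_div_factorial_atTop c).const_mul (m * c)
  rw [mul_zero] at h
  obtain ⟨M, hM⟩ := Filter.eventually_atTop.1 (h.eventually_lt_const one_pos)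
  obtain ⟨p, hp, hprime⟩ := Nat.exists_infinite_primes (max (N + 1) (M + 1))
  refine ⟨p, hprime, (le_max_left _ _).trans hp, ?_⟩
  have hp' : M + 1 ≤ p := (le_max_right _ _).trans hp
  have := hM (p - 1) (by omega)
  obtain ⟨r, rfl⟩ : ∃ r, p = r + 1 := ⟨p - 1, by omega⟩
  rw [Nat.add_sub_cancel] at this ⊢
  refine lt_of_eq_of_lt ?_ this
  rw [pow_succ]
  ring

/-- A Galois-stable sum of exponentials of algebraic numbers, at least one of which is zero, does
not vanish. -/
theorem sum_exp_ne_zero_of_galois_stable {E ι : Type*} [Field E] [Algebra ℚ E]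
    [FiniteDimensional ℚ E] [IsGalois ℚ E] [Fintype ι] (φ : E →+* ℂ) (β : ι → E)
    (hβ : ∀ σ : E ≃ₐ[ℚ] E, ∃ e : ι ≃ ι, ∀ i, σ (β i) = β (e i)) {i₀ : ι} (hi₀ : β i₀ = 0) :
    ∑ i, Complex.exp (φ (β i)) ≠ 0 := by
  classical
  intro hsum
  obtain ⟨f, hf0, hf⟩ := exists_int_polynomial_aeval_eq_zero β
  obtain ⟨D, hD0, hD⟩ := exists_int_smul_isIntegral β
  obtain ⟨c, hc⟩ := LindemannWeierstrass.exp_polynomial_approx f hf0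
  set s : Finset ι := Finset.univ.filter fun i ↦ β i ≠ 0
  set k : ℕ := (Finset.univ.filter fun i ↦ ¬ β i ≠ 0).card with hk
  have hk0 : 0 < k := Finset.card_pos.2 ⟨i₀, by simp [hi₀]⟩
  have hsum' : ∑ i ∈ s, Complex.exp (φ (β i)) = -k := by
    rw [← Finset.sum_filter_add_sum_filter_not _ fun i ↦ β i ≠ 0] at hsum
    rw [eq_neg_iff_add_eq_zero, ← hsum]
    congr 1
    rw [hk, Finset.card_eq_sum_ones, Nat.cast_sum]
    refine Finset.sum_congr rfl fun i hi ↦ ?_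
    have : β i = 0 := by simpa using hi
    simp [this]
  -- Exceeding |f(0)| allows Hermite's approximation; exceeding k and |D| keeps p from dividing k
  -- and D.
  obtain ⟨p, hp, hpN, hlt⟩ := exists_prime_gt_mul_pow_div_factorial_lt_one
    (max (f.eval 0).natAbs (max k D.natAbs)) s.card ((|D| : ℤ) ^ f.natDegree * c)
  obtain ⟨hp1, hp2, hp3⟩ : (f.eval 0).natAbs < p ∧ k < p ∧ D.natAbs < p := by
    simpa using hpN
  obtain ⟨n, hn, g, hg, hbound⟩ := hc p hp1 hp
  set N := p * f.natDegree
  obtain ⟨z, hz⟩ : ∃ z : ℤ, (z : E) = D ^ N • ∑ i ∈ s, aeval (β i) g := by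
    apply exists_intCast_eq_of_isIntegral_of_fixed
    · rw [Finset.smul_sum]
      exact IsIntegral.sum _ fun i _ ↦
        g.isIntegral_smul_aeval (hD i) (hg.trans (Nat.sub_le _ _))
    · intro σ
      obtain ⟨e, he⟩ := hβ σ
      rw [map_zsmul, map_sum]
      congr 1
      refine Finset.sum_equiv e (fun i ↦ ?_) fun i _ ↦ ?_
      · simp only [s, Finset.mem_filter, Finset.mem_univ, true_and, ← he]
        simp
      · rw [← he]
        exact (aeval_algHom_apply (σ.toAlgHom.restrictScalars ℤ) (β i) g).symm
  have hzC : (z : ℂ) = D ^ N * ∑ i ∈ s, aeval (φ (β i)) g := by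
    have := congrArg φ hz
    rw [map_intCast, map_zsmul, map_sum] at this
    rw [this, zsmul_eq_mul]
    push_cast
    congr 1
    exact Finset.sum_congr rfl fun i _ ↦ (aeval_algHom_apply φ.toIntAlgHom (β i) g).symm
  have hf' (i) (hi : i ∈ s) : φ (β i) ∈ f.aroots ℂ := by
    have hi' : β i ≠ 0 := by simpa [s] using hi
    rw [mem_aroots]
    refine ⟨fun h ↦ hf0 (by simp [h]), ?_⟩
    have := congrArg φ (hf i hi')
    rwa [map_zero, ← RingHom.toIntAlgHom_apply φ, ← aeval_algHom_apply] at this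
  -- This integer is −D^N times the sum of the approximation errors, hence zero; then p divides D^N
  -- n k, which is impossible.
  have hest : ‖((D ^ N * (n * k) + p * z : ℤ) : ℂ)‖ < 1 := by
    have h1 : ((D ^ N * (n * k) + p * z : ℤ) : ℂ) =
        -(D ^ N * ∑ i ∈ s, (n • Complex.exp (φ (β i)) - p • aeval (φ (β i)) g)) := by
      rw [Finset.sum_sub_distrib, ← Finset.smul_sum, ← Finset.smul_sum, hsum']
      push_cast
      rw [hzC]
      simp only [zsmul_eq_mul, nsmul_eq_mul]
      ring
    rw [h1, norm_neg, norm_mul, norm_pow]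
    have h2 : ‖∑ i ∈ s, (n • Complex.exp (φ (β i)) - p • aeval (φ (β i)) g)‖ ≤
        s.card * (c ^ p / (p - 1).factorial) := by
      rw [← nsmul_eq_mul]
      exact (norm_sum_le _ _).trans (Finset.sum_le_card_nsmul _ _ _ fun i hi ↦ hbound (hf' i hi))
    refine lt_of_le_of_lt (mul_le_mul_of_nonneg_left h2 (by positivity)) (lt_of_eq_of_lt ?_ hlt)
    rw [mul_pow, ← pow_mul, mul_comm f.natDegree p, Complex.norm_intCast, Int.cast_abs]
    ring
  rw [Complex.norm_intCast, ← Int.cast_abs, ← Int.cast_one, Int.cast_lt, Int.abs_lt_one_iff] at hest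
  have hpZ : Prime (p : ℤ) := Nat.prime_iff_prime_int.1 hp
  have hdvd : (p : ℤ) ∣ D ^ N * (n * k) := ⟨-z, by linarith⟩
  rcases hpZ.dvd_or_dvd hdvd with h | h
  · have := Nat.le_of_dvd (Int.natAbs_pos.2 hD0) (Int.natCast_dvd.1 (hpZ.dvd_of_dvd_pow h))
    omega
  · rcases hpZ.dvd_or_dvd h with h | h
    · exact hn h
    · have := Nat.le_of_dvd hk0 (Int.natCast_dvd_natCast.1 h)
      omega

/-- Multiplying 1 + exp(σα) over all σ and expanding gives a Galois-stable sum of exponentials of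
subset sums; the empty subset supplies the exponent 0. -/
theorem one_add_exp_ne_zero_of_isAlgebraic {α : ℂ} (hα : IsAlgebraic ℚ α) :
    1 + Complex.exp α ≠ 0 := by
  classical
  intro h0
  have hint : IsIntegral ℚ α := hα.isIntegral
  let E : IntermediateField ℚ ℂ := IntermediateField.adjoin ℚ ((minpoly ℚ α).rootSet ℂ)
  have hsplit : IsSplittingField ℚ E (minpoly ℚ α) :=
    IntermediateField.adjoin_rootSet_isSplittingField (IsAlgClosed.splits _)
  have : FiniteDimensional ℚ E := IsSplittingField.finiteDimensional E (minpoly ℚ α)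
  have : IsGalois ℚ E :=
    IsGalois.of_separable_splitting_field (minpoly.irreducible hint).separable
  have hαE : α ∈ E := IntermediateField.subset_adjoin _ _
    ((mem_rootSet_of_ne (minpoly.ne_zero hint)).2 (minpoly.aeval ℚ α))
  let x : E := ⟨α, hαE⟩
  let β : Finset (E ≃ₐ[ℚ] E) → E := fun S ↦ ∑ σ ∈ S, σ x
  refine sum_exp_ne_zero_of_galois_stable (ι := Finset (E ≃ₐ[ℚ] E)) (algebraMap E ℂ) β (fun τ ↦
    ⟨(Equiv.mulLeft τ).finsetCongr, fun S ↦ ?_⟩) (i₀ := ∅) (by simp [β]) ?_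
  · simp [β, map_sum, Finset.sum_map]
  · have : ∏ σ : E ≃ₐ[ℚ] E, (1 + Complex.exp (algebraMap E ℂ (σ x))) = 0 :=
      Finset.prod_eq_zero (Finset.mem_univ 1) h0
    rw [Finset.prod_one_add, Finset.powerset_univ] at this
    rw [← this]
    refine Finset.sum_congr rfl fun S _ ↦ ?_
    rw [← Complex.exp_sum, map_sum]

theorem transcendental_pi : Transcendental ℚ (Real.pi : ℂ) := by
  intro h
  have hI : IsAlgebraic ℚ Complex.I := by
    refine ⟨X ^ 2 + 1, ?_, by simp⟩
    exact (monic_X_pow_add_C (1 : ℚ) two_ne_zero).ne_zero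
  refine one_add_exp_ne_zero_of_isAlgebraic (h.mul hI) ?_
  rw [Complex.exp_pi_mul_I]
  ring

open HurwitzZeta ZMod

/-! ### Hurwitz values, roots of unity and L-values. -/

theorem ZMod.sinZeta_toAddCircle_odd {N : ℕ} [NeZero N] {m : ℕ} (hm : m ≠ 0) (j : ZMod N) :
    ∃ r : ℚ, sinZeta (toAddCircle j) (2 * m + 1) = Real.pi ^ (2 * m + 1) * r := by
  have h01 : (j.val / N : ℝ) ∈ Set.Icc (0 : ℝ) 1 :=
    ⟨by positivity, (div_le_one (Nat.cast_pos.mpr <| NeZero.pos _)).mpr <|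
      Nat.cast_le.mpr (val_lt j).le⟩
  refine ⟨(-1) ^ (m + 1) * 2 ^ (2 * m + 1) / 2 / (2 * m + 1).factorial *
    (Polynomial.bernoulli (2 * m + 1)).eval (j.val / N : ℚ), ?_⟩
  rw [toAddCircle_apply, sinZeta_two_mul_nat_add_one hm h01]
  have : ((j.val / N : ℝ) : ℂ) = algebraMap ℚ ℂ (j.val / N) := by
    rw [eq_ratCast, Rat.cast_div, Rat.cast_natCast, Rat.cast_natCast, Complex.ofReal_div,
      Complex.ofReal_natCast, Complex.ofReal_natCast]
  rw [this, Polynomial.eval_map_algebraMap, Polynomial.aeval_algebraMap_apply_eq_algebraMap_eval,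
    mul_pow]
  push_cast
  simp only [eq_ratCast]
  ring

/-- Finite Fourier inversion: the transform of j ↦ e(ja/N) is N times the indicator of a. -/
theorem ZMod.hurwitzZeta_toAddCircle_eq_sum {N : ℕ} [NeZero N] (a : ZMod N) {s : ℂ} (hs : s ≠ 1) :
    (N : ℂ) * ((N : ℂ) ^ (-s) * hurwitzZeta (toAddCircle a) s) =
      ∑ j : ZMod N, stdAddChar (j * a) * expZeta (toAddCircle (-j)) s := by
  rw [← LFunction_dft (fun j : ZMod N ↦ stdAddChar (j * a)) (.inr hs), LFunction]
  have (m : ZMod N) : (dft fun j : ZMod N ↦ (stdAddChar (j * a) : ℂ)) m =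
      if m = a then (N : ℂ) else 0 := by
    rw [dft_apply]
    have h := AddChar.sum_mulShift (a - m) (isPrimitive_stdAddChar N)
    simp only [ZMod.card, sub_eq_zero, Nat.cast_ite, Nat.cast_zero] at h
    simp only [eq_comm (a := m), ← h, smul_eq_mul, ← AddChar.map_add_eq_mul]
    refine Finset.sum_congr rfl fun j _ ↦ ?_
    congr 1
    ring
  simp_rw [this]
  simp
  ring

/-- For odd `k > 1`, the differences `ζ(k, a / N) - ζ(k, 1 - a / N)` are `i * π ^ k` times
elements of the `N`-th cyclotomic field that are permuted by the Galois action. -/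
theorem ZMod.exists_hurwitzZeta_sub_eq {N k : ℕ} [NeZero N] (hk : 1 < k) (hodd : Odd k) :
    ∃ b : ZMod N → ℚ, ∀ a : ZMod N,
      hurwitzZeta (toAddCircle a) k - hurwitzZeta (toAddCircle (-a)) k =
        (Complex.I * Real.pi ^ k) * ∑ j : ZMod N, (b j : ℂ) * stdAddChar (j * a) := by
  obtain ⟨m, rfl⟩ := hodd
  have hm : m ≠ 0 := by omega
  choose r hr using fun j : ZMod N ↦ sinZeta_toAddCircle_odd hm j
  have hs : ((2 * m + 1 : ℕ) : ℂ) ≠ 1 := by exact_mod_cast hk.ne'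
  have hN : (N : ℂ) ≠ 0 := NeZero.ne _
  -- The cosine parts cancel in the difference, the sine parts double, and N^(k−1) undoes N ·
  -- N^(−k).
  refine ⟨fun j ↦ -2 * (N : ℚ) ^ (2 * m) * r j, fun a ↦ ?_⟩
  have h1 := hurwitzZeta_toAddCircle_eq_sum a hs
  have h2 := hurwitzZeta_toAddCircle_eq_sum (-a) hs
  rw [← Equiv.sum_comp (Equiv.neg (ZMod N))] at h2
  simp only [Equiv.neg_apply, neg_mul_neg, neg_neg] at h2
  have h3 : (N : ℂ) * (N : ℂ) ^ (-((2 * m + 1 : ℕ) : ℂ)) * (N : ℂ) ^ (2 * m) = 1 := by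
    rw [Complex.cpow_neg, Complex.cpow_natCast]
    field_simp
    ring
  have h4 : (N : ℂ) * (N : ℂ) ^ (-((2 * m + 1 : ℕ) : ℂ)) *
      (hurwitzZeta (toAddCircle a) (2 * m + 1 : ℕ) - hurwitzZeta (toAddCircle (-a)) (2 * m + 1 : ℕ)) =
      -2 * Complex.I * Real.pi ^ (2 * m + 1) * ∑ j : ZMod N, (r j : ℂ) * stdAddChar (j * a) := by
    rw [mul_sub, mul_assoc, mul_assoc, h1, h2, ← Finset.sum_sub_distrib, Finset.mul_sum]
    refine Finset.sum_congr rfl fun j _ ↦ ?_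
    have := hr j
    simp only [expZeta, map_neg, cosZeta_neg, sinZeta_neg]
    push_cast
    rw [this]
    ring
  calc _ = (N : ℂ) ^ (2 * m) * ((N : ℂ) * (N : ℂ) ^ (-((2 * m + 1 : ℕ) : ℂ)) *
      (hurwitzZeta (toAddCircle a) (2 * m + 1 : ℕ) -
        hurwitzZeta (toAddCircle (-a)) (2 * m + 1 : ℕ))) := by
        rw [← mul_assoc, mul_comm ((N : ℂ) ^ (2 * m)), h3, one_mul]
    _ = _ := by
        rw [h4, Finset.mul_sum, Finset.mul_sum, Finset.mul_sum]
        refine Finset.sum_congr rfl fun j _ ↦ ?_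
        push_cast
        ring

theorem DirichletCharacter.sum_units_mul_hurwitzZeta {N : ℕ} [NeZero N]
    (χ : DirichletCharacter ℂ N) (s : ℂ) :
    ∑ u : (ZMod N)ˣ, χ u * hurwitzZeta (toAddCircle (u : ZMod N)) s =
      (N : ℂ) ^ s * χ.LFunction s := by
  have hN : (N : ℂ) ^ s ≠ 0 := by simp [NeZero.ne N]
  have : (N : ℂ) ^ s * χ.LFunction s =
      ∑ j : ZMod N, χ j * hurwitzZeta (toAddCircle j) s := by
    rw [DirichletCharacter.LFunction, ZMod.LFunction, Complex.cpow_neg, mul_inv_cancel_left₀ hN]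
  rw [this]
  refine Fintype.sum_of_injective (fun u : (ZMod N)ˣ ↦ (u : ZMod N)) Units.val_injective _ _
    (fun j hj ↦ ?_) fun _ ↦ rfl
  rw [χ.map_nonunit, zero_mul]
  rintro ⟨u, rfl⟩
  exact hj ⟨u, rfl⟩

theorem DirichletCharacter.sum_units_mul_hurwitzZeta_ne_zero {N k : ℕ} [NeZero N]
    (hk : 1 < k) (χ : DirichletCharacter ℂ N) :
    ∑ u : (ZMod N)ˣ, χ u * hurwitzZeta (toAddCircle (u : ZMod N)) k ≠ 0 := by
  rw [sum_units_mul_hurwitzZeta]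
  refine mul_ne_zero (by simp [NeZero.ne N]) (χ.LFunction_ne_zero_of_one_le_re (.inr ?_) ?_)
  · exact_mod_cast hk.ne'
  · simpa using hk.le

/-- The trivial character gives ζ(k) times rational Euler factors. -/
theorem exists_rat_mul_riemannZeta_eq_sum_hurwitzZeta {N k : ℕ} [NeZero N] (hk : 1 < k) :
    ∃ c : ℚ, c ≠ 0 ∧
      ∑ u : (ZMod N)ˣ, hurwitzZeta (toAddCircle (u : ZMod N)) k = c * riemannZeta k := by
  have h := (1 : DirichletCharacter ℂ N).sum_units_mul_hurwitzZeta k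
  have h0 := (1 : DirichletCharacter ℂ N).sum_units_mul_hurwitzZeta_ne_zero hk
  have hk1 : (k : ℂ) ≠ 1 := by exact_mod_cast hk.ne'
  have h1 := DirichletCharacter.LFunctionTrivChar_eq_mul_riemannZeta (N := N) hk1
  rw [DirichletCharacter.LFunctionTrivChar] at h1
  rw [h1] at h
  have hone : ∑ u : (ZMod N)ˣ, (1 : DirichletCharacter ℂ N) u *
      hurwitzZeta (toAddCircle (u : ZMod N)) k =
      ∑ u : (ZMod N)ˣ, hurwitzZeta (toAddCircle (u : ZMod N)) k :=
    Finset.sum_congr rfl fun u _ ↦ by rw [MulChar.one_apply_coe, one_mul]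
  rw [hone] at h h0
  have hc : ∑ u : (ZMod N)ˣ, hurwitzZeta (toAddCircle (u : ZMod N)) k =
      (((N : ℚ) ^ k * ∏ p ∈ N.primeFactors, (1 - ((p : ℚ) ^ k)⁻¹) : ℚ) : ℂ) * riemannZeta k := by
    rw [h]
    push_cast
    simp only [Complex.cpow_neg, Complex.cpow_natCast]
    ring
  refine ⟨_, fun h' ↦ h0 ?_, hc⟩
  rw [hc, h', Rat.cast_zero, zero_mul]

/-! ### Okada's theorem over K. -/

/-- The Galois action turns one relation into all its translates. Pairing these with an odd χ
factors into a Fourier coefficient of c times 2N^k L(k,χ) ≠ 0, so only the even part of c survives.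
-/
theorem ZMod.eq_apply_neg_of_sum_mul_hurwitzZeta_sub_eq_zero {N k : ℕ} [NeZero N] (hk : 1 < k)
    (hodd : Odd k) (K : Subfield ℂ) (hirr : Irreducible (cyclotomic N K)) (c : (ZMod N)ˣ → K)
    (h0 : ∑ a : (ZMod N)ˣ, (c a : ℂ) *
      (hurwitzZeta (toAddCircle (a : ZMod N)) k - hurwitzZeta (toAddCircle (-a : ZMod N)) k) = 0)
    (a : (ZMod N)ˣ) : c a = c (-a) := by
  classical
  obtain ⟨b, hb⟩ := exists_hurwitzZeta_sub_eq (N := N) hk hodd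
  have hpi : Complex.I * (Real.pi : ℂ) ^ k ≠ 0 := by simp [Real.pi_ne_zero]
  set w : (ZMod N)ˣ → ℂ := fun a ↦
    hurwitzZeta (toAddCircle (a : ZMod N)) k - hurwitzZeta (toAddCircle (-a : ZMod N)) k with hw
  have hexpand (v : (ZMod N)ˣ) : ∑ a, (c a : ℂ) * w (v * a) = Complex.I * Real.pi ^ k *
      ∑ i : (ZMod N)ˣ × ZMod N, ((c i.1 * (b i.2 : K) : K) : ℂ) *
        stdAddChar ((v : ZMod N) * (i.2 * (i.1 : ZMod N))) := by
    rw [Fintype.sum_prod_type, Finset.mul_sum]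
    refine Finset.sum_congr rfl fun a _ ↦ ?_
    rw [hw]
    dsimp only
    rw [hb, mul_left_comm, Finset.mul_sum]
    congr 1
    refine Finset.sum_congr rfl fun j _ ↦ ?_
    rw [Units.val_mul, mul_left_comm j]
    push_cast
    ring
  have hshift (v : (ZMod N)ˣ) : ∑ a, (c a : ℂ) * w (v * a) = 0 := by
    have h1 := hexpand 1
    simp only [one_mul, Units.val_one] at h1
    rw [h0, eq_comm, mul_eq_zero, or_iff_right hpi] at h1
    rw [hexpand, K.sum_mul_stdAddChar_unit_mul_eq_zero hirr v _ _ h1, mul_zero]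
  have hoddchar (χ : DirichletCharacter ℂ N) (hχ : χ.Odd) :
      ∑ a, (c a : ℂ) * χ (a⁻¹ : (ZMod N)ˣ) = 0 := by
    have hL : ∑ v : (ZMod N)ˣ, χ v * w v ≠ 0 := by
      have hneg : ∑ v : (ZMod N)ˣ, χ v * hurwitzZeta (toAddCircle (-v : ZMod N)) k =
          -∑ v : (ZMod N)ˣ, χ v * hurwitzZeta (toAddCircle (v : ZMod N)) k := by
        rw [← Equiv.sum_comp (Equiv.neg (ZMod N)ˣ), ← Finset.sum_neg_distrib]
        refine Finset.sum_congr rfl fun v _ ↦ ?_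
        rw [Equiv.neg_apply, Units.val_neg, hχ.eval_neg, neg_neg, neg_mul]
      simp only [hw, mul_sub, Finset.sum_sub_distrib]
      rw [hneg, sub_neg_eq_add, ← two_mul]
      exact mul_ne_zero two_ne_zero (χ.sum_units_mul_hurwitzZeta_ne_zero hk)
    have h2 : ∑ v : (ZMod N)ˣ, χ v * ∑ a, (c a : ℂ) * w (v * a) =
        (∑ a, (c a : ℂ) * χ (a⁻¹ : (ZMod N)ˣ)) * ∑ v : (ZMod N)ˣ, χ v * w v := by
      simp only [Finset.mul_sum, Finset.sum_mul]
      rw [Finset.sum_comm]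
      conv_rhs => rw [Finset.sum_comm]
      refine Finset.sum_congr rfl fun a _ ↦ ?_
      rw [← Equiv.sum_comp (Equiv.mulRight a⁻¹)]
      refine Finset.sum_congr rfl fun v _ ↦ ?_
      rw [Equiv.coe_mulRight, inv_mul_cancel_right, Units.val_mul, map_mul]
      ring
    simp only [hshift, mul_zero, Finset.sum_const_zero] at h2
    exact (mul_eq_zero.1 h2.symm).resolve_right hL
  -- This is twice the odd part of c: even characters annihilate it by parity, odd ones by
  -- `hoddchar`, so orthogonality gives d = 0.
  set d : (ZMod N)ˣ → ℂ := fun a ↦ c a - c (-a) with hd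
  have hchar (χ : DirichletCharacter ℂ N) : ∑ a, d a * χ (a⁻¹ : (ZMod N)ˣ) = 0 := by
    have hneg : ∑ a : (ZMod N)ˣ, (c (-a) : ℂ) * χ (a⁻¹ : (ZMod N)ˣ) =
        χ (-1) * ∑ a : (ZMod N)ˣ, (c a : ℂ) * χ (a⁻¹ : (ZMod N)ˣ) := by
      rw [← Equiv.sum_comp (Equiv.neg (ZMod N)ˣ), Finset.mul_sum]
      refine Finset.sum_congr rfl fun v _ ↦ ?_
      rw [Equiv.neg_apply, neg_neg, inv_neg, Units.val_neg, ← neg_one_mul, map_mul]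
      ring
    simp only [hd, sub_mul, Finset.sum_sub_distrib]
    rw [hneg]
    rcases χ.even_or_odd with hχ | hχ
    · rw [hχ, one_mul, sub_self]
    · rw [hoddchar χ hχ, mul_zero, sub_zero]
  have hfinal : d a * N.totient = 0 := by
    calc d a * N.totient
        = ∑ x : (ZMod N)ˣ, d x * if (x : ZMod N) = a then (N.totient : ℂ) else 0 := by
          rw [Finset.sum_eq_single a]
          · simp
          · intro x _ hx
            rw [if_neg (fun h ↦ hx (Units.ext h)), mul_zero]
          · simp
      _ = ∑ χ : DirichletCharacter ℂ N, (∑ x, d x * χ (x⁻¹ : (ZMod N)ˣ)) * χ a := by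
          simp only [← DirichletCharacter.sum_char_inv_mul_char_eq ℂ (Units.isUnit _),
            Finset.mul_sum, Finset.sum_mul]
          rw [Finset.sum_comm]
          refine Finset.sum_congr rfl fun χ _ ↦ Finset.sum_congr rfl fun x _ ↦ ?_
          rw [ZMod.inv_coe_unit, mul_assoc]
      _ = 0 := Finset.sum_eq_zero fun χ _ ↦ by rw [hchar, zero_mul]
  have hphi : (N.totient : ℂ) ≠ 0 := by
    exact_mod_cast (Nat.totient_pos.2 (NeZero.pos N)).ne'
  have := (mul_eq_zero.1 hfinal).resolve_right hphi
  exact Subtype.ext (sub_eq_zero.1 this)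

/-- Representatives of the units modulo `N` up to sign. -/
abbrev ZMod.HalfUnits (N : ℕ) : Type := {a : (ZMod N)ˣ // 2 * (a : ZMod N).val < N}

theorem ZMod.two_mul_val_neg_unit_lt_iff {N : ℕ} [NeZero N] (hN : 2 < N) (a : (ZMod N)ˣ) :
    2 * ((-a : (ZMod N)ˣ) : ZMod N).val < N ↔ ¬ 2 * (a : ZMod N).val < N := by
  have : Fact (1 < N) := ⟨by omega⟩
  have h0 : NeZero (a : ZMod N) := ⟨a.ne_zero⟩
  rw [Units.val_neg, ZMod.val_neg_of_ne_zero]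
  have hlt := ZMod.val_lt (a : ZMod N)
  have hne : 2 * (a : ZMod N).val ≠ N := by
    intro h
    have hcop := ZMod.val_coe_unit_coprime a
    have h1 : (a : ZMod N).val = 1 := Nat.Coprime.eq_one_of_dvd hcop ⟨2, by omega⟩
    omega
  omega

theorem ZMod.two_mul_card_halfUnits {N : ℕ} [NeZero N] (hN : 2 < N) :
    2 * Fintype.card (HalfUnits N) = N.totient := by
  have e : HalfUnits N ≃ {a : (ZMod N)ˣ // ¬ 2 * (a : ZMod N).val < N} :=
    (Equiv.neg (ZMod N)ˣ).subtypeEquiv fun a ↦ by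
      rw [Equiv.neg_apply, two_mul_val_neg_unit_lt_iff hN, not_not]
  rw [two_mul, ← ZMod.card_units_eq_totient N]
  nth_rw 2 [Fintype.card_congr e]
  exact (Fintype.card_congr (Equiv.sumCompl fun a : (ZMod N)ˣ ↦ 2 * (a : ZMod N).val < N)) ▸
    Fintype.card_sum.symm

/-- Okada's theorem for odd `k`, with coefficients in `K`. -/
theorem ZMod.linearIndependent_hurwitzZeta_sub {N k : ℕ} [NeZero N] (hN : 2 < N) (hk : 1 < k)
    (hodd : Odd k) (K : Subfield ℂ) (hirr : Irreducible (cyclotomic N K)) :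
    LinearIndependent K fun a : HalfUnits N ↦
      hurwitzZeta (toAddCircle (a.1 : ZMod N)) k -
        hurwitzZeta (toAddCircle (-a.1 : ZMod N)) k := by
  rw [Fintype.linearIndependent_iff]
  intro g hg a
  set c : (ZMod N)ˣ → K := fun x ↦ if h : 2 * (x : ZMod N).val < N then g ⟨x, h⟩ else 0 with hc
  have h0 : ∑ a : (ZMod N)ˣ, (c a : ℂ) *
      (hurwitzZeta (toAddCircle (a : ZMod N)) k -
        hurwitzZeta (toAddCircle (-a : ZMod N)) k) = 0 := by
    rw [← hg]
    refine (Fintype.sum_of_injective (Subtype.val : HalfUnits N → (ZMod N)ˣ)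
      Subtype.val_injective _ _ (fun x hx ↦ ?_) fun x ↦ ?_).symm
    · have : ¬ 2 * (x : ZMod N).val < N := fun h ↦ hx ⟨⟨x, h⟩, rfl⟩
      simp [hc, this]
    · simp only [hc, x.2, dif_pos]
      rfl
  -- Extended by zero, the coefficient at −a vanishes, since −a is not a representative.
  have := eq_apply_neg_of_sum_mul_hurwitzZeta_sub_eq_zero hk hodd K hirr c h0 a.1
  have hneg : ¬ 2 * ((-a.1 : (ZMod N)ˣ) : ZMod N).val < N := by
    rw [two_mul_val_neg_unit_lt_iff hN, not_not]
    exact a.2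
  simp only [hc] at this
  rwa [dif_pos a.2, dif_neg hneg] at this

/-! ### Relations forced by a small Hurwitz space. -/

theorem hurwitzSpace_finite (k q : ℕ) (K : Subfield ℂ) : Module.Finite K (hurwitzSpace k q K) := by
  refine FiniteDimensional.span_of_finite K (Set.Finite.insert _ ?_)
  refine ((Set.finite_lt_nat q).image fun a : ℕ ↦
    hurwitzZeta (((a : ℝ) / (q : ℝ) : ℝ) : UnitAddCircle) (k : ℂ)).subset ?_
  rintro z ⟨a, -, haq, -, rfl⟩
  exact ⟨a, haq, rfl⟩

theorem hurwitzZeta_toAddCircle_unit_mem_hurwitzSpace {k q : ℕ} [NeZero q] (hq : 2 < q)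
    (K : Subfield ℂ) (u : (ZMod q)ˣ) :
    hurwitzZeta (toAddCircle (u : ZMod q)) k ∈ hurwitzSpace k q K := by
  have : Fact (1 < q) := ⟨by omega⟩
  refine Submodule.subset_span (Or.inr ⟨(u : ZMod q).val, ?_, ZMod.val_lt _,
    ZMod.val_coe_unit_coprime u, ?_⟩)
  · exact Nat.pos_of_ne_zero ((ZMod.val_eq_zero _).not.2 u.ne_zero)
  · rw [toAddCircle_apply]

theorem hurwitzZeta_sub_mem_hurwitzSpace {k q : ℕ} [NeZero q] (hq : 2 < q) (K : Subfield ℂ)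
    (u : (ZMod q)ˣ) :
    hurwitzZeta (toAddCircle (u : ZMod q)) k - hurwitzZeta (toAddCircle (-u : ZMod q)) k ∈
      hurwitzSpace k q K :=
  sub_mem (hurwitzZeta_toAddCircle_unit_mem_hurwitzSpace hq K u)
    (by simpa using hurwitzZeta_toAddCircle_unit_mem_hurwitzSpace (k := k) hq K (-u))

theorem riemannZeta_mem_hurwitzSpace {k q : ℕ} (hk : 1 < k) (hq : 2 < q) (K : Subfield ℂ) :
    riemannZeta k ∈ hurwitzSpace k q K := by
  have : NeZero q := ⟨by omega⟩
  obtain ⟨c, hc0, hc⟩ := exists_rat_mul_riemannZeta_eq_sum_hurwitzZeta (N := q) hk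
  have hmem : (c : ℂ) * riemannZeta k ∈ hurwitzSpace k q K := by
    rw [← hc]
    exact sum_mem fun u _ ↦ hurwitzZeta_toAddCircle_unit_mem_hurwitzSpace hq K u
  have := (hurwitzSpace k q K).smul_mem (c⁻¹ : K) hmem
  rw [Subfield.smul_def, smul_eq_mul] at this
  push_cast at this
  rwa [inv_mul_cancel_left₀ (by exact_mod_cast hc0)] at this

/-- If the Hurwitz space is small, a nontrivial combination of `1` and `ζ(k)` lies in the span of
the differences `ζ(k, a / q) - ζ(k, 1 - a / q)`. -/
theorem exists_add_mul_riemannZeta_eq_of_finrank_hurwitzSpace_lt {k q : ℕ} [NeZero q]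
    (hk : 1 < k) (hodd : Odd k) (hq : 2 < q) (K : Subfield ℂ)
    (hirr : Irreducible (cyclotomic q K))
    (hlt : (Module.finrank K (hurwitzSpace k q K) : ℚ) < q.totient / 2 + 2) :
    ∃ α β : K, (α ≠ 0 ∨ β ≠ 0) ∧ ∃ c : HalfUnits q → K,
      (α : ℂ) + β * riemannZeta k = ∑ a, (c a : ℂ) * (hurwitzZeta (toAddCircle (a.1 : ZMod q)) k -
        hurwitzZeta (toAddCircle (-a.1 : ZMod q)) k) := by
  set w : HalfUnits q → ℂ := fun a ↦ hurwitzZeta (toAddCircle (a.1 : ZMod q)) k -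
    hurwitzZeta (toAddCircle (-a.1 : ZMod q)) k with hw
  have hwli : LinearIndependent K w := linearIndependent_hurwitzZeta_sub hq hk hodd K hirr
  -- A family of φ(q)/2 + 2 members of the space: too many to be independent.
  set v : Option (Option (HalfUnits q)) → ℂ := fun i ↦
    i.elim 1 fun i ↦ i.elim (riemannZeta k) w with hv
  have hmem (i) : v i ∈ hurwitzSpace k q K := by
    rcases i with _ | _ | a
    · exact Submodule.subset_span (Or.inl rfl)
    · exact riemannZeta_mem_hurwitzSpace hk hq K
    · exact hurwitzZeta_sub_mem_hurwitzSpace hq K a.1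
  have hdep : ¬ LinearIndependent K v := by
    intro hli
    have := hurwitzSpace_finite k q K
    have h1 : LinearIndependent K fun i ↦ (⟨v i, hmem i⟩ : hurwitzSpace k q K) :=
      LinearIndependent.of_comp (hurwitzSpace k q K).subtype hli
    have h2 := h1.fintype_card_le_finrank
    simp only [Fintype.card_option] at h2
    have h3 := two_mul_card_halfUnits hq
    have h2' : (Fintype.card (HalfUnits q) : ℚ) + 1 + 1 ≤
      Module.finrank K (hurwitzSpace k q K) := by exact_mod_cast h2
    have h3' : 2 * (Fintype.card (HalfUnits q) : ℚ) = q.totient := by exact_mod_cast h3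
    linarith
  obtain ⟨g, hg, i, hi⟩ := Fintype.not_linearIndependent_iff.1 hdep
  rw [Fintype.sum_option, Fintype.sum_option] at hg
  simp only [hv, Option.elim, Subfield.smul_def, smul_eq_mul, mul_one] at hg
  refine ⟨g none, g (some none), ?_, fun a ↦ -g (some (some a)), ?_⟩
  · by_contra! h0
    simp only [h0, ZeroMemClass.coe_zero, zero_mul, zero_add] at hg
    have hz := Fintype.linearIndependent_iff.1 hwli (fun a ↦ g (some (some a))) hg
    rcases i with _ | _ | a
    · exact hi h0.1
    · exact hi h0.2
    · exact hi (hz a)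
  · simp only [NegMemClass.coe_neg, neg_mul, Finset.sum_neg_distrib]
    linear_combination hg

/-! ### Comparing coprime levels q and r. -/

theorem ZMod.stdAddChar_natCast_mul {n q r : ℕ} [NeZero q] [NeZero r] [NeZero n] (hn : n = r * q)
    (m : ℕ) : (stdAddChar ((r * m : ℕ) : ZMod n) : ℂ) = stdAddChar (m : ZMod q) := by
  have h1 := stdAddChar_coe (N := n) (r * m : ℕ)
  have h2 := stdAddChar_coe (N := q) m
  have hr : (r : ℂ) ≠ 0 := NeZero.ne _
  have hq : (q : ℂ) ≠ 0 := NeZero.ne _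
  rw [Int.cast_natCast] at h1 h2
  rw [h1, h2, hn]
  congr 1
  push_cast
  field_simp

theorem Nat.Coprime.exists_unit_eq_neg_one_and_eq_one {q r : ℕ} [NeZero q] [NeZero r]
    (h : q.Coprime r) :
    ∃ v : ℕ, v.Coprime (q * r) ∧ (v : ZMod q) = -1 ∧ (v : ZMod r) = 1 := by
  obtain ⟨v, hv1, hv2⟩ := Nat.chineseRemainder h ((-1 : ZMod q).val) 1
  have h1 : (v : ZMod q) = -1 := by
    rw [(ZMod.natCast_eq_natCast_iff _ _ _).2 hv1, ZMod.natCast_zmod_val]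
  have h2 : (v : ZMod r) = 1 := by
    rw [(ZMod.natCast_eq_natCast_iff _ _ _).2 hv2, Nat.cast_one]
  refine ⟨v, Nat.Coprime.mul_right ?_ ?_, h1, h2⟩
  · rw [← ZMod.isUnit_iff_coprime, h1]
    exact isUnit_one.neg
  · rw [← ZMod.isUnit_iff_coprime, h2]
    exact isUnit_one

/-- A `K`-linear combination of `q`-th roots of unity that equals a combination of `r`-th roots of
unity, with `q` and `r` coprime, is invariant under inversion of the roots of unity. -/
theorem Subfield.sum_mul_stdAddChar_neg_eq {q r : ℕ} [NeZero q] [NeZero r] (K : Subfield ℂ)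
    (hqr : q.Coprime r) (hirr : Irreducible (cyclotomic (q * r) K)) {ι κ : Type*} [Fintype ι]
    [Fintype κ] (d : ι → K) (t : ι → ZMod q) (e : κ → K) (s : κ → ZMod r)
    (h : ∑ i, (d i : ℂ) * stdAddChar (t i) = ∑ i, (e i : ℂ) * stdAddChar (s i)) :
    ∑ i, (d i : ℂ) * stdAddChar (-t i) = ∑ i, (d i : ℂ) * stdAddChar (t i) := by
  obtain ⟨v, hv, hvq, hvr⟩ := hqr.exists_unit_eq_neg_one_and_eq_one
  have hq (m : ℕ) : (stdAddChar ((r * m : ℕ) : ZMod (q * r)) : ℂ) = stdAddChar (m : ZMod q) :=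
    stdAddChar_natCast_mul (mul_comm q r) m
  have hr (m : ℕ) : (stdAddChar ((q * m : ℕ) : ZMod (q * r)) : ℂ) = stdAddChar (m : ZMod r) :=
    stdAddChar_natCast_mul rfl m
  -- Both sides are written with qr-th roots of unity, and the unit v, which is −1 mod q and 1 mod
  -- r, acts on the difference.
  have key := K.sum_mul_stdAddChar_unit_mul_eq_zero hirr (ZMod.unitOfCoprime v hv)
    (Sum.elim d fun i ↦ -e i)
    (Sum.elim (fun i ↦ ((r * (t i).val : ℕ) : ZMod (q * r)))
      fun i ↦ ((q * (s i).val : ℕ) : ZMod (q * r)))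
    (by
      rw [Fintype.sum_sum_type]
      simp only [Sum.elim_inl, Sum.elim_inr, hq, hr, ZMod.natCast_zmod_val, NegMemClass.coe_neg,
        neg_mul, Finset.sum_neg_distrib]
      rw [h, add_neg_cancel])
  have hmq (m : ZMod q) : (stdAddChar ((v : ZMod (q * r)) * ((r * m.val : ℕ) : ZMod (q * r))) : ℂ) =
      stdAddChar (-m) := by
    rw [← Nat.cast_mul, mul_left_comm, hq, Nat.cast_mul, hvq, ZMod.natCast_zmod_val, neg_one_mul]
  have hmr (m : ZMod r) : (stdAddChar ((v : ZMod (q * r)) * ((q * m.val : ℕ) : ZMod (q * r))) : ℂ) =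
      stdAddChar m := by
    rw [← Nat.cast_mul, mul_left_comm, hr, Nat.cast_mul, hvr, ZMod.natCast_zmod_val, one_mul]
  rw [Fintype.sum_sum_type] at key
  simp only [Sum.elim_inl, Sum.elim_inr, ZMod.coe_unitOfCoprime, hmq, hmr, NegMemClass.coe_neg,
    neg_mul, Finset.sum_neg_distrib, ← h] at key
  linear_combination key

theorem ZMod.isAlgebraic_stdAddChar {N : ℕ} [NeZero N] (j : ZMod N) :
    IsAlgebraic ℚ (stdAddChar j : ℂ) := by
  refine IsIntegral.isAlgebraic (IsIntegral.of_pow (NeZero.pos N) ?_)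
  rw [← AddChar.map_nsmul_eq_pow]
  simpa using isIntegral_one

/-- An element of the span of the differences `ζ(k, a / q) - ζ(k, 1 - a / q)`, written by means of
roots of unity; inversion of the roots of unity changes its sign. -/
theorem ZMod.exists_sum_mul_hurwitzZeta_sub_eq {N k : ℕ} [NeZero N] (hk : 1 < k) (hodd : Odd k)
    (K : Subfield ℂ) (c : HalfUnits N → K) :
    ∃ (d : HalfUnits N × ZMod N → K) (t : HalfUnits N × ZMod N → ZMod N),
      ∑ a, (c a : ℂ) * (hurwitzZeta (toAddCircle (a.1 : ZMod N)) k -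
        hurwitzZeta (toAddCircle (-a.1 : ZMod N)) k) =
        Complex.I * Real.pi ^ k * ∑ i, (d i : ℂ) * stdAddChar (t i) ∧
      ∑ i, (d i : ℂ) * stdAddChar (-t i) = -∑ i, (d i : ℂ) * stdAddChar (t i) := by
  obtain ⟨b, hb⟩ := exists_hurwitzZeta_sub_eq (N := N) hk hodd
  have hpi : Complex.I * (Real.pi : ℂ) ^ k ≠ 0 := by simp [Real.pi_ne_zero]
  have hexpand (f : HalfUnits N → ZMod N) :
      ∑ a, (c a : ℂ) * (hurwitzZeta (toAddCircle (f a)) k - hurwitzZeta (toAddCircle (-f a)) k) =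
        Complex.I * Real.pi ^ k * ∑ i : HalfUnits N × ZMod N,
          ((c i.1 * (b i.2 : K) : K) : ℂ) * stdAddChar (i.2 * f i.1) := by
    rw [Fintype.sum_prod_type, Finset.mul_sum]
    refine Finset.sum_congr rfl fun a _ ↦ ?_
    rw [hb, mul_left_comm, Finset.mul_sum]
    congr 1
    refine Finset.sum_congr rfl fun j _ ↦ ?_
    push_cast
    ring
  refine ⟨fun i ↦ c i.1 * (b i.2 : K), fun i ↦ i.2 * (i.1.1 : ZMod N),
    hexpand fun a ↦ (a.1 : ZMod N), mul_left_cancel₀ hpi ?_⟩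
  have h1 := hexpand fun a ↦ (a.1 : ZMod N)
  -- The coefficients do not depend on `f`, so replacing a by −a inverts each root of unity while
  -- the differences change sign.
  have h2 := hexpand fun a ↦ -(a.1 : ZMod N)
  simp only [neg_neg, mul_neg] at h1 h2 ⊢
  rw [← h1, ← h2, ← Finset.sum_neg_distrib]
  refine Finset.sum_congr rfl fun a _ ↦ ?_
  ring

/-! ### The main argument. -/

theorem theorem3p5 (k q r : ℕ) (hk : 1 < k) (hk_odd : Odd k) (hq : 2 < q) (hr : 2 < r)
    (hqr : Nat.Coprime q r) (K : Subfield ℂ) [NumberField K] (hK_real : ∀ x ∈ K, x.im = 0)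
    (hdisc : IsCoprime (NumberField.discr K) ((q : ℤ) * (r : ℤ)))
    (hzeta : riemannZeta (k : ℂ) ∉ K) :
    (Nat.totient q : ℚ) / 2 + 2 ≤ (Module.finrank K (hurwitzSpace k q K) : ℚ) ∨
      (Nat.totient r : ℚ) / 2 + 2 ≤ (Module.finrank K (hurwitzSpace k r K) : ℚ) := by
  have : NeZero q := ⟨by omega⟩
  have : NeZero r := ⟨by omega⟩
  by_contra! hlt
  have hirr : Irreducible (cyclotomic (q * r) K) :=
    K.irreducible_cyclotomic_of_isCoprime_discr (by exact_mod_cast hdisc)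
  obtain ⟨α, β, hαβ, c, hc⟩ := exists_add_mul_riemannZeta_eq_of_finrank_hurwitzSpace_lt hk hk_odd hq
    K (K.irreducible_cyclotomic_of_isCoprime_discr hdisc.of_mul_right_left) hlt.1
  obtain ⟨γ, δ, hγδ, c', hc'⟩ := exists_add_mul_riemannZeta_eq_of_finrank_hurwitzSpace_lt hk hk_odd
    hr K (K.irreducible_cyclotomic_of_isCoprime_discr hdisc.of_mul_right_right) hlt.2
  have hne {a b : K} (h : a ≠ 0 ∨ b ≠ 0) : (a : ℂ) + b * riemannZeta k ≠ 0 := by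
    intro h0
    by_cases hb : b = 0
    · simp only [hb, ZeroMemClass.coe_zero, zero_mul, add_zero, ZeroMemClass.coe_eq_zero] at h0
      exact h.elim (· h0) (· hb)
    · have hb' : (b : ℂ) ≠ 0 := by exact_mod_cast hb
      refine hzeta ?_
      have : riemannZeta k = ((-a / b : K) : ℂ) := by
        push_cast
        field_simp
        linear_combination h0
      rw [this]
      exact SetLike.coe_mem _
  have hpi : Complex.I * (Real.pi : ℂ) ^ k ≠ 0 := by simp [Real.pi_ne_zero]
  obtain ⟨d, t, hd, hodd⟩ := exists_sum_mul_hurwitzZeta_sub_eq hk hk_odd K c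
  obtain ⟨d', t', hd', -⟩ := exists_sum_mul_hurwitzZeta_sub_eq hk hk_odd K c'
  rw [hd] at hc
  rw [hd'] at hc'
  set x : ℂ := ∑ i, (d i : ℂ) * stdAddChar (t i) with hx
  set y : ℂ := ∑ i, (d' i : ℂ) * stdAddChar (t' i) with hy
  have hx0 : x ≠ 0 := by
    intro h
    exact hne hαβ (by rw [hc, h, mul_zero])
  -- Inverting the q-th roots of unity must fix ax, as it equals by, yet it negates x; so ax = 0.
  have hprop {a b : K} (h : (a : ℂ) * x = b * y) : a = 0 := by
    have h1 := K.sum_mul_stdAddChar_neg_eq hqr hirr (fun i ↦ a * d i) t (fun i ↦ b * d' i) t' (by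
      simp only [MulMemClass.coe_mul, mul_assoc, ← Finset.mul_sum]
      exact h)
    simp only [MulMemClass.coe_mul, mul_assoc, ← Finset.mul_sum] at h1
    rw [hodd, ← hx] at h1
    have h2 : (a : ℂ) * x = 0 := by linear_combination -h1 / 2
    exact_mod_cast (mul_eq_zero.1 h2).resolve_right hx0
  by_cases hdet : (α : ℂ) * δ - β * γ = 0
  · have h1 : (γ : ℂ) * x = α * y := by
      apply mul_left_cancel₀ hpi
      linear_combination (-γ : ℂ) * hc + α * hc' - riemannZeta k * hdet
    have h2 : (δ : ℂ) * x = β * y := by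
      apply mul_left_cancel₀ hpi
      linear_combination (-δ : ℂ) * hc + β * hc' + hdet
    exact hγδ.elim (· (hprop h1)) (· (hprop h2))
  · have hK (a : K) : IsAlgebraic ℚ (a : ℂ) := (Algebra.IsAlgebraic.isAlgebraic a).algebraMap
    have hI : IsAlgebraic ℚ Complex.I :=
      (Complex.isIntegral_rat_I).isAlgebraic
    have hsum {N : ℕ} [NeZero N] {ι : Type} [Fintype ι] (d : ι → K) (t : ι → ZMod N) :
        IsAlgebraic ℚ (∑ i, (d i : ℂ) * stdAddChar (t i)) := by
      rw [← mem_algebraicClosure_iff]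
      exact sum_mem fun i _ ↦ mem_algebraicClosure_iff.2 ((hK _).mul (isAlgebraic_stdAddChar _))
    have hxa : IsAlgebraic ℚ x := hsum d t
    have hya : IsAlgebraic ℚ y := hsum d' t'
    have hkey : (Real.pi : ℂ) ^ k * (Complex.I * (δ * x - β * y)) = α * δ - β * γ := by
      linear_combination (-δ : ℂ) * hc + β * hc'
    have hz : Complex.I * (δ * x - β * y) ≠ 0 := by
      intro h
      rw [h, mul_zero] at hkey
      exact hdet hkey.symm
    have hpik : (Real.pi : ℂ) ^ k = (α * δ - β * γ) * (Complex.I * (δ * x - β * y))⁻¹ := by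
      rw [← hkey, mul_inv_cancel_right₀ hz]
    refine transcendental_pi (IsAlgebraic.of_pow (by omega : 0 < k) ?_)
    rw [hpik]
    exact (((hK α).mul (hK δ)).sub ((hK β).mul (hK γ))).mul
      (hI.mul (((hK δ).mul hxa).sub ((hK β).mul hya))).inv
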